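/- **Setting.** Let $(p_n)_{n\ge 0}$ be a sequence of positive numbers, decreasing monotonically to $0$, with $p_0=1$. The *infinite step billiard* with heights $(p_n)$ is the billiard in the table $\bigcup_{n\ge 0}[n,n+1]\times[0,p_n]$. For $\vartheta\in\,]0,\pi/2[$, its invariant surface $S(\vartheta)$ is obtained by unfolding four copies of the table: in coordinates $(X,Y)$ it is the region $\{|Y|\le p_n \text{ for } n\le |X|\le n+1\}$ in which $(X,p_n)$ is identified with $(X,-p_n)$ for $n<|X|<n+1$, and, for $k\ge 1$, the vertical wall points $(k,Y)$ and $(-k,Y)$, $p_k\le|Y|\le p_{k-1}$, are identified. On it the billiard flow is the straight-line motion with velocity $(\cos\vartheta,\sin\vartheta)$. Orbits that meet a vertex are continued by continuity from above; in particular, an orbit arriving at $X=n$ passes through the aperture $G_n=\{n\}\times[-p_n,p_n[$ if it arrives at a point of $G_n$, and hits a vertical wall otherwise. Let $L=\{0\}\times[-1,1[\;\simeq[-1,1[$, and let $E^{(n)}_\vartheta\subset L$ be the set of points whose forward orbit in the direction $\vartheta$ reaches $G_n$ without colliding with any vertical wall after its start. For $A\subset\mathbb R$, let $\mathrm{n.i.}(A)$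 be the least number of nonempty right-open intervals $[a,b[$ whose union is $A$. **Theorem.** Suppose that there is a $\lambda$ with $$0<\lambda<\lambda_0:=\frac{\sqrt6-1}{5}\qquad\text{and}\qquad p_{n+1}\le\lambda\,p_n\quad\text{for all } n\ge 0 .$$ Then for Lebesgue-almost every direction $\vartheta\in\,]0,\pi/2[$ there is a strictly increasing sequence $(n_j)$ of natural numbers such that $\mathrm{n.i.}(E^{(n_j)}_\vartheta)=1$ for all $j$, that is, each $E^{(n_j)}_\vartheta$ is a single nonempty interval $[a_j,b_j[\;\subset[-1,1[$. -/

import Mathlib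

open Real Set Filter Topology MeasureTheory

noncomputable section

/-- An infinite step billiard: its table is `⋃ n, [n, n+1] × [0, p n]`, where the heights `p n` are
positive, decrease monotonically to zero, and `p 0 = 1`. -/
structure StepBilliard where
  p : ℕ → ℝ
  pos : ∀ n, 0 < p n
  zero_eq_one : p 0 = 1
  antitone : Antitone p
  tendsto_zero : Tendsto p atTop (𝓝 0)

namespace StepBilliard

variable (B : StepBilliard)

/-- Four copies of the table, reflected in the axes, make up a planar region which meets the
vertical strip `m ≤ X < m + 1`, for `m : ℤ`, in a rectangle of half-height `height m`. -/
def height : ℤ → ℝ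
  | Int.ofNat k => B.p k
  | Int.negSucc k => B.p k

lemma height_pos (m : ℤ) : 0 < B.height m := by
  cases m with
  | ofNat k => exact B.pos k
  | negSucc k => exact B.pos k

/-- The top and the bottom side of the rectangle over `[m, m + 1]` are identified: the vertical
coordinate in this strip lives on a circle of length `2 * height m`, represented by the interval
`[-height m, height m)`. -/
def wrap (m : ℤ) (y : ℝ) : ℝ :=
  toIcoMod (mul_pos two_pos (B.height_pos m)) (-B.height m) y

/-- The invariant surface of the billiard flow in coordinates `(X, Y)`, with one representative
for each point. The upper sides are identified with the lower ones, and a point `(k, Y)` of a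
vertical wall at `X = k ≥ 1`, which is a point with `Y ∉ [-p k, p k)`, is identified with
`(-k, Y)`, the latter being the chosen representative. By the convention of continuity from
above, of the segment `X = k` the point `(k, -p k)` belongs to the opening and `(k, p k)` to the
wall. -/
def surface : Set (ℝ × ℝ) :=
  {z | z.2 ∈ Ico (-B.height ⌊z.1⌋) (B.height ⌊z.1⌋)}

/-- The vertical walls on the surface: the segment `X = 0`, and for `k ≥ 1` the points `(k, Y)`,
identified with `(-k, Y)`, with `Y` outside `[-p k, p k)`. -/
def walls : Set (ℝ × ℝ) :=
  {z ∈ B.surface | z.1 = 0 ∨ ∃ k : ℕ, 1 ≤ k ∧ z.1 = -(k : ℝ) ∧ z.2 ∉ Ico (-B.p k) (B.p k)}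

/-- The `n`-th aperture `{n} × [-p n, p n)`. -/
def aperture (n : ℕ) : Set (ℝ × ℝ) := {(n : ℝ)} ×ˢ Ico (-B.p n) (B.p n)

/-- The motion with slope `tan θ` from the left end `X = m` of one strip to the left end of the next
one. A state `(m, y)` stands for the point `(m, y)`. The trajectory arrives at `X = m + 1` with
vertical coordinate `y' = wrap m (y + tan θ)`. If `m + 1 ≥ 1` and `y'` lies outside
`[-p (m+1), p (m+1))`, it hits a vertical wall and goes on from `(-(m + 1), y')`; otherwise it goes
on from `(m + 1, y')`. -/
def cross (θ : ℝ) : ℤ × ℝ → ℤ × ℝ := fun e =>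
  open Classical in
  let y' := B.wrap e.1 (e.2 + tan θ)
  if 0 ≤ e.1 ∧ y' ∉ Ico (-B.height (e.1 + 1)) (B.height (e.1 + 1)) then (-(e.1 + 1), y')
  else (e.1 + 1, y')

/-- The unit speed billiard flow on the surface in the direction `θ ∈ (0, π/2)`, for times
`t ≥ 0`. Here `s` is the horizontal distance that the trajectory has covered at time `t`,
counted from the left end of the strip that contains the starting point `z`. -/
def flow (θ t : ℝ) (z : ℝ × ℝ) : ℝ × ℝ :=
  let s : ℝ := Int.fract z.1 + t * cos θ
  let e : ℤ × ℝ := (B.cross θ)^[⌊s⌋₊] (⌊z.1⌋, z.2 - Int.fract z.1 * tan θ)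
  let r : ℝ := s - ⌊s⌋₊
  (e.1 + r, B.wrap e.1 (e.2 + r * tan θ))

/-- The set `E_θ^(n)` of the points of `L = {0} × [-1, 1)`, identified with `[-1, 1)`, whose forward
orbit in the direction `θ` reaches the `n`-th aperture directly, that is, without colliding with
any vertical wall after the start. -/
def directSet (θ : ℝ) (n : ℕ) : Set ℝ :=
  {y | y ∈ Ico (-1 : ℝ) 1 ∧ ∃ t : ℝ, 0 ≤ t ∧ B.flow θ t (0, y) ∈ B.aperture n ∧
    ∀ s ∈ Ioc 0 t, B.flow θ s (0, y) ∉ B.walls}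

end StepBilliard

/-- The number of intervals of `A`: the least number of nonempty right-open intervals `[a, b)` whose
union is `A` (infinity if `A` is not such a finite union). -/
def numIntervals (A : Set ℝ) : ℕ∞ :=
  ⨅ (k : ℕ) (_ : ∃ a b : Fin k → ℝ, (∀ i, a i < b i) ∧ A = ⋃ i, Ico (a i) (b i)), (k : ℕ∞)

end

/-! ### Direct trajectories as iterated wrapping -/

namespace StepBilliard

/-! Pull the aperture `G_n` back strip by strip. Its preimage in strip `k` is an arc of a circle of
length `2 * p k`, and it remains one interval unless the cut point, the corner `(k, -p k)`, lies
inside it. So `E_θ^(n)` is a single interval of length `2 * p n` whenever no corner with `k < n`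
reaches `G_n` directly (`exists_eq_Ico_of_corners`).

Slopes `τ` in `[a, b]` for which corner `k` reaches `G_n`, `n = k + j + 1`, are rare. The height on
arrival is `(j + 1) * τ + c` with at most `((b - a) / (2 * p k) + 2) * 3 ^ j` offsets `c`
(`exists_offsets`), and each offset allows slopes of measure `2 * p n / (j + 1)`. Since `p n ≤ λ ^
(j + 1) * p k`, summing over corners gives at most `49/50 * (b - a)` plus an error of order `(3 * λ)
^ n`. By Lebesgue density, the slopes that are bad for all large `n` form a null set; every other
slope is good for infinitely many `n`. -/

lemma height_natCast (B : StepBilliard) (n : ℕ) : B.height (n : ℤ) = B.p n := rfl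

lemma height_neg_succ (B : StepBilliard) (n : ℕ) : B.height (-((n : ℤ) + 1)) = B.p n := by
  rw [← Int.negSucc_eq]; rfl

lemma wrap_mem (B : StepBilliard) (m : ℤ) (y : ℝ) :
    B.wrap m y ∈ Ico (-B.height m) (B.height m) := by
  have h := toIcoMod_mem_Ico (mul_pos two_pos (B.height_pos m)) (-B.height m) y
  rwa [show -B.height m + 2 * B.height m = B.height m by ring] at h

lemma exists_wrap_eq (B : StepBilliard) (m : ℤ) (y : ℝ) :
    ∃ q : ℤ, B.wrap m y = y - q * (2 * B.height m) :=
  ⟨toIcoDiv (mul_pos two_pos (B.height_pos m)) (-B.height m) y, by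
    rw [wrap, toIcoMod, zsmul_eq_mul]⟩

lemma wrap_eq_of_mem (B : StepBilliard) {m : ℤ} {y z : ℝ}
    (hz : z ∈ Ico (-B.height m) (B.height m)) (q : ℤ) (h : z = y - q * (2 * B.height m)) :
    B.wrap m y = z := by
  refine (toIcoMod_eq_iff _).2 ⟨?_, q, ?_⟩
  · rwa [show -B.height m + 2 * B.height m = B.height m by ring]
  · rw [h, zsmul_eq_mul]; ring

lemma wrap_of_mem (B : StepBilliard) {m : ℤ} {y : ℝ}
    (hy : y ∈ Ico (-B.height m) (B.height m)) : B.wrap m y = y :=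
  B.wrap_eq_of_mem hy 0 (by simp)

/-- The vertical coordinate, after `j` strips, of the trajectory with slope `τ` which starts from
`(k, y)` and is continued through the walls. -/
noncomputable def orbit (B : StepBilliard) (τ : ℝ) (k : ℕ) (y : ℝ) : ℕ → ℝ
  | 0 => y
  | j + 1 => B.wrap ((k + j : ℕ) : ℤ) (orbit B τ k y j + τ)

/-- The trajectory with slope `τ` from `(k, y)` passes through the apertures `k, …, k + j`. -/
def Reaches (B : StepBilliard) (τ : ℝ) (k j : ℕ) (y : ℝ) : Prop :=
  ∀ i ≤ j, B.orbit τ k y i ∈ Ico (-B.p (k + i)) (B.p (k + i))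

lemma orbit_succ_eq (B : StepBilliard) (τ : ℝ) (k : ℕ) (y : ℝ) (j : ℕ) :
    B.orbit τ k y (j + 1) = B.orbit τ (k + 1) (B.wrap (k : ℤ) (y + τ)) j := by
  induction j with
  | zero => rfl
  | succ j ih =>
    rw [orbit, ih, orbit, show k + (j + 1) = k + 1 + j by omega]

lemma reaches_succ_iff (B : StepBilliard) (τ : ℝ) (k j : ℕ) (y : ℝ) :
    B.Reaches τ k (j + 1) y ↔
      y ∈ Ico (-B.p k) (B.p k) ∧ B.Reaches τ (k + 1) j (B.wrap (k : ℤ) (y + τ)) := by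
  constructor
  · intro h
    refine ⟨h 0 (Nat.zero_le _), fun i hi => ?_⟩
    have := h (i + 1) (by omega)
    rwa [orbit_succ_eq, show k + (i + 1) = k + 1 + i by omega] at this
  · rintro ⟨h0, h⟩ i hi
    cases i with
    | zero => exact h0
    | succ i =>
      rw [orbit_succ_eq, show k + (i + 1) = k + 1 + i by omega]
      exact h i (by omega)

lemma Reaches.mono {B : StepBilliard} {τ : ℝ} {k i j : ℕ} {y : ℝ} (h : B.Reaches τ k j y)
    (hij : i ≤ j) : B.Reaches τ k i y :=
  fun l hl => h l (hl.trans hij)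

lemma cross_iterate_of_reaches {B : StepBilliard} {θ y : ℝ} {m : ℕ}
    (h : B.Reaches (tan θ) 0 m y) :
    (B.cross θ)^[m] (0, y) = ((m : ℤ), B.orbit (tan θ) 0 y m) := by
  induction m with
  | zero => rfl
  | succ m ih =>
    rw [Function.iterate_succ_apply', ih (h.mono m.le_succ)]
    have h1 := h (m + 1) le_rfl
    simp only [orbit, Nat.zero_add] at h1
    have h2 : ¬ (0 ≤ (m : ℤ) ∧ B.wrap (m : ℤ) (B.orbit (tan θ) 0 y m + tan θ) ∉
        Ico (-B.height ((m : ℤ) + 1)) (B.height ((m : ℤ) + 1))) := by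
      rintro ⟨-, h3⟩
      exact h3 h1
    simp only [cross, if_neg h2, orbit, Nat.zero_add]
    push_cast
    rfl

lemma cross_iterate_succ_of_not_mem {B : StepBilliard} {θ y : ℝ} {m : ℕ}
    (h : B.Reaches (tan θ) 0 m y)
    (h' : B.orbit (tan θ) 0 y (m + 1) ∉ Ico (-B.p (m + 1)) (B.p (m + 1))) :
    (B.cross θ)^[m + 1] (0, y) = (-((m : ℤ) + 1), B.orbit (tan θ) 0 y (m + 1)) := by
  rw [Function.iterate_succ_apply', cross_iterate_of_reaches h]
  simp only [orbit, Nat.zero_add] at h'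
  have h2 : 0 ≤ (m : ℤ) ∧ B.wrap (m : ℤ) (B.orbit (tan θ) 0 y m + tan θ) ∉
      Ico (-B.height ((m : ℤ) + 1)) (B.height ((m : ℤ) + 1)) := ⟨Int.natCast_nonneg m, h'⟩
  simp only [cross, if_pos h2, orbit, Nat.zero_add]

lemma flow_zero_left (B : StepBilliard) (θ t y : ℝ) :
    B.flow θ t (0, y) =
      (((((B.cross θ)^[⌊t * cos θ⌋₊] (0, y)).1 : ℤ) : ℝ) + (t * cos θ - ⌊t * cos θ⌋₊),
        B.wrap ((B.cross θ)^[⌊t * cos θ⌋₊] (0, y)).1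
          (((B.cross θ)^[⌊t * cos θ⌋₊] (0, y)).2 + (t * cos θ - ⌊t * cos θ⌋₊) * tan θ)) := by
  simp [flow]

lemma flow_natCast_div_cos (B : StepBilliard) {θ : ℝ} (hθ : 0 < cos θ) (m : ℕ) (y : ℝ) :
    B.flow θ (m / cos θ) (0, y) =
      (((((B.cross θ)^[m] (0, y)).1 : ℤ) : ℝ),
        B.wrap ((B.cross θ)^[m] (0, y)).1 ((B.cross θ)^[m] (0, y)).2) := by
  rw [flow_zero_left, div_mul_cancel₀ _ hθ.ne', Nat.floor_natCast]
  simp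

lemma exists_last_reached {B : StepBilliard} {τ y : ℝ} {k m : ℕ} (h0 : B.Reaches τ k 0 y)
    (h : ¬ B.Reaches τ k m y) :
    ∃ i < m, B.Reaches τ k i y ∧
      B.orbit τ k y (i + 1) ∉ Ico (-B.p (k + (i + 1))) (B.p (k + (i + 1))) := by
  induction m with
  | zero => exact absurd h0 h
  | succ m ih =>
    by_cases hm : B.Reaches τ k m y
    · refine ⟨m, m.lt_succ_self, hm, fun h1 => h fun i hi => ?_⟩
      rcases Nat.le_succ_iff.1 hi with hi | rfl
      exacts [hm i hi, h1]
    · obtain ⟨i, hi, h1⟩ := ih hm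
      exact ⟨i, by omega, h1⟩

/-- A point of `L` belongs to `E_θ^(n)` exactly if the trajectory passes through the apertures
`0, …, n` one after the other. -/
lemma directSet_eq (B : StepBilliard) {θ : ℝ} (hθ : 0 < cos θ) (n : ℕ) :
    B.directSet θ n = {y | B.Reaches (tan θ) 0 n y} := by
  ext y
  constructor
  · rintro ⟨hy, t, ht, hap, hwall⟩
    have h0 : B.Reaches (tan θ) 0 0 y := fun i hi => by
      obtain rfl : i = 0 := by omega
      simpa [B.zero_eq_one, orbit] using hy
    have hs : 0 ≤ t * cos θ := mul_nonneg ht hθ.le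
    by_cases hm : B.Reaches (tan θ) 0 ⌊t * cos θ⌋₊ y
    · rw [flow_zero_left, cross_iterate_of_reaches hm] at hap
      have h1 : ((⌊t * cos θ⌋₊ : ℤ) : ℝ) + (t * cos θ - ⌊t * cos θ⌋₊) = n := hap.1
      have h2 : t * cos θ = n := by push_cast at h1; linarith
      rwa [h2, Nat.floor_natCast] at hm
    · exfalso
      obtain ⟨i, hi, hr, ho⟩ := exists_last_reached h0 hm
      -- The first missed aperture puts the orbit on a wall at time `(i + 1) / cos θ ≤ t`.
      have h1 : ((i + 1 : ℕ) : ℝ) ≤ t * cos θ := (Nat.le_floor_iff hs).1 hi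
      refine hwall (((i + 1 : ℕ) : ℝ) / cos θ) ⟨by positivity, (div_le_iff₀ hθ).2 h1⟩ ?_
      rw [Nat.zero_add] at ho
      have h3 : B.orbit (tan θ) 0 y (i + 1) ∈
          Ico (-B.height (-((i : ℤ) + 1))) (B.height (-((i : ℤ) + 1))) := by
        rw [height_neg_succ, orbit, Nat.zero_add]
        exact B.wrap_mem (i : ℤ) _
      rw [flow_natCast_div_cos B hθ, cross_iterate_succ_of_not_mem hr ho]
      simp only [B.wrap_of_mem h3]
      refine ⟨?_, Or.inr ⟨i + 1, by omega, by push_cast; rfl, ho⟩⟩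
      simp only [surface, mem_ofPred_eq, Int.floor_intCast]
      exact h3
  · intro h
    have hy := h 0 (Nat.zero_le _)
    simp only [orbit, Nat.add_zero, B.zero_eq_one] at hy
    refine ⟨hy, n / cos θ, by positivity, ?_, ?_⟩
    · rw [flow_natCast_div_cos B hθ, cross_iterate_of_reaches h]
      have h1 := h n le_rfl
      rw [Nat.zero_add] at h1
      refine ⟨by simp, ?_⟩
      simpa only [B.wrap_of_mem (m := (n : ℤ)) h1] using h1
    -- Until then `X > 0`, whereas the chosen representatives of wall points have `X ≤ 0`.
    · rintro s ⟨hs0, hs⟩ ⟨-, hw⟩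
      have hs1 : 0 < s * cos θ := mul_pos hs0 hθ
      have hs2 : s * cos θ ≤ n := (le_div_iff₀ hθ).1 hs
      have hm : ⌊s * cos θ⌋₊ ≤ n := Nat.floor_le_of_le hs2
      rw [flow_zero_left, cross_iterate_of_reaches (h.mono hm)] at hw
      simp only [Int.cast_natCast, add_sub_cancel] at hw
      rcases hw with hw | ⟨k, -, hw, -⟩
      · linarith
      · have : (0 : ℝ) ≤ k := k.cast_nonneg
        linarith

/-! ### Pulling an aperture back past the corners -/

lemma exists_eq_Ico_of_corners (B : StepBilliard) (τ : ℝ) (j : ℕ) : ∀ k : ℕ,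
    (∀ i < j, ¬ B.Reaches τ (k + i) (j - i) (-B.p (k + i))) →
    ∃ a : ℝ, {y | B.Reaches τ k j y} = Ico a (a + 2 * B.p (k + j)) := by
  induction j with
  | zero =>
    intro k _
    refine ⟨-B.p k, ?_⟩
    ext y
    simp only [Reaches, mem_ofPred_eq, Nat.le_zero, forall_eq, orbit, Nat.add_zero, mem_Ico]
    rw [show -B.p k + 2 * B.p k = B.p k by ring]
  | succ j ih =>
    intro k h
    obtain ⟨a, ha⟩ := ih (k + 1) fun i hi hr => h (i + 1) (by omega) (by
      rw [show k + (i + 1) = k + 1 + i by omega, show j + 1 - (i + 1) = j - i by omega]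
      exact hr)
    have hn := B.pos (k + (j + 1))
    rw [show k + 1 + j = k + (j + 1) by omega] at ha
    have hpk := B.pos k
    have hanti : B.p (k + 1) ≤ B.p k := B.antitone k.le_succ
    have hmem : ∀ x ∈ Ico a (a + 2 * B.p (k + (j + 1))),
        x ∈ Ico (-B.p k) (B.p k) := fun x hx => by
      rw [← ha] at hx
      have := hx 0 (Nat.zero_le _)
      simp only [orbit, Nat.add_zero] at this
      exact ⟨by linarith [this.1], by linarith [this.2]⟩
    have hiff : ∀ y, B.Reaches τ k (j + 1) y ↔ y ∈ Ico (-B.p k) (B.p k) ∧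
        B.wrap (k : ℤ) (y + τ) ∈ Ico a (a + 2 * B.p (k + (j + 1))) := fun y => by
      rw [reaches_succ_iff, ← ha]; rfl
    obtain ⟨q, hq⟩ := B.exists_wrap_eq (k : ℤ) (a - τ)
    have ha' := B.wrap_mem (k : ℤ) (a - τ)
    set a' := B.wrap (k : ℤ) (a - τ)
    rw [height_natCast] at hq ha'
    -- If the arc overran the top `p k`, it would contain `p k` in its interior; this point is
    -- identified with the corner `-p k`, which would then reach the last aperture.
    have hle : a' + 2 * B.p (k + (j + 1)) ≤ B.p k := by
      by_contra! hlt
      refine h 0 (by omega) ((hiff _).2 ⟨⟨le_rfl, by simp only [Nat.add_zero]; linarith⟩, ?_⟩)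
      have hz : a + (B.p k - a') ∈ Ico a (a + 2 * B.p (k + (j + 1))) :=
        ⟨by linarith [ha'.2], by linarith⟩
      rw [B.wrap_eq_of_mem (m := (k : ℤ)) (z := a + (B.p k - a')) (hmem _ hz) (-q - 1) ?_]
      · exact hz
      · rw [height_natCast, hq]; push_cast; simp only [Nat.add_zero]; ring
    refine ⟨a', ?_⟩
    ext y
    rw [mem_ofPred_eq, hiff]
    constructor
    · rintro ⟨hy, hw⟩
      obtain ⟨r, hr⟩ := B.exists_wrap_eq (k : ℤ) (y + τ)
      set w := B.wrap (k : ℤ) (y + τ)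
      rw [height_natCast] at hr
      have h1 : a' + (w - a) ∈ Ico (-B.p k) (B.p k) :=
        ⟨by linarith [ha'.1, hw.1], by linarith [hw.2]⟩
      have h2 : y = a' + (w - a) :=
        (B.wrap_of_mem (m := (k : ℤ)) hy).symm.trans
          (B.wrap_eq_of_mem (m := (k : ℤ)) h1 (r + q) (by
            rw [height_natCast, hq, hr]; push_cast; ring))
      rw [h2]
      exact ⟨by linarith [hw.1], by linarith [hw.2]⟩
    · rintro ⟨h1, h2⟩
      have hz : a + (y - a') ∈ Ico a (a + 2 * B.p (k + (j + 1))) :=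
        ⟨by linarith, by linarith⟩
      refine ⟨⟨by linarith [ha'.1], by linarith⟩, ?_⟩
      rw [B.wrap_eq_of_mem (m := (k : ℤ)) (z := a + (y - a')) (hmem _ hz) (-q) ?_]
      · exact hz
      · rw [height_natCast, hq]; push_cast; ring

end StepBilliard

lemma numIntervals_Ico {a b : ℝ} (h : a < b) : numIntervals (Ico a b) = 1 := by
  apply le_antisymm
  · exact (iInf₂_le 1 ⟨fun _ => a, fun _ => b, fun _ => h, (iUnion_const _).symm⟩).trans (by simp)
  · refine le_iInf₂ fun k hk => ?_
    obtain ⟨u, v, -, huv⟩ := hk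
    rcases Nat.eq_zero_or_pos k with rfl | hk
    · have h0 : a ∈ Ico a b := ⟨le_rfl, h⟩
      rw [huv] at h0
      simp at h0
    · exact_mod_cast hk

/-! ### Measure of the slopes that send a corner to an aperture -/

namespace StepBilliard

/-- Each wrap only shifts the height by a constant, so the height stays affine in `τ`. The length `b
- a` matters for the first strip alone: later, a given offset already confines `τ` so tightly that
at most three wrapping numbers lead through the next aperture. -/
lemma exists_offsets (B : StepBilliard) (k : ℕ) {a b : ℝ} (hab : a ≤ b) (j : ℕ) :
    ∃ S : Finset ℝ, (S.card : ℝ) ≤ ((b - a) / (2 * B.p k) + 2) * 3 ^ j ∧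
      ∀ τ ∈ Icc a b, B.Reaches τ k (j + 1) (-B.p k) →
        ∃ c ∈ S, B.orbit τ k (-B.p k) (j + 1) = (j + 1) * τ + c := by
  induction j with
  | zero =>
    have hP : 0 < 2 * B.p k := mul_pos two_pos (B.pos k)
    refine ⟨(Finset.Ioc ⌊a / (2 * B.p k) - 1⌋ ⌊b / (2 * B.p k)⌋).image
      fun m : ℤ => -B.p k - m * (2 * B.p k), ?_, ?_⟩
    · have h1 : ⌊a / (2 * B.p k) - 1⌋ ≤ ⌊b / (2 * B.p k)⌋ :=
        Int.floor_le_floor (by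
          have : a / (2 * B.p k) ≤ b / (2 * B.p k) := by gcongr
          linarith)
      have h2 := Int.floor_le (b / (2 * B.p k))
      have h3 := Int.lt_floor_add_one (a / (2 * B.p k) - 1)
      refine (Nat.cast_le.2 Finset.card_image_le).trans ?_
      have h4 : (((⌊b / (2 * B.p k)⌋ - ⌊a / (2 * B.p k) - 1⌋).toNat : ℤ) : ℝ) =
          ⌊b / (2 * B.p k)⌋ - ⌊a / (2 * B.p k) - 1⌋ := by
        rw [Int.toNat_of_nonneg (by omega)]; push_cast; rfl
      rw [Int.card_Ioc, ← Int.cast_natCast, h4, sub_div, pow_zero]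
      linarith
    · intro τ hτ hr
      have h1 := hr 1 le_rfl
      have hanti : B.p (k + 1) ≤ B.p k := B.antitone k.le_succ
      obtain ⟨m, hm⟩ := B.exists_wrap_eq (k : ℤ) (-B.p k + τ)
      simp only [orbit, Nat.add_zero] at h1 ⊢
      rw [hm, height_natCast] at h1 ⊢
      refine ⟨_, Finset.mem_image.2 ⟨m, Finset.mem_Ioc.2 ⟨?_, ?_⟩, rfl⟩, by push_cast; ring⟩
      · rw [Int.floor_lt, sub_lt_iff_lt_add, div_lt_iff₀ hP]
        linarith [h1.2, hτ.1]
      · rw [Int.le_floor, le_div_iff₀ hP]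
        linarith [h1.1, hτ.2]
  | succ j ih =>
    obtain ⟨S, hS, hSr⟩ := ih
    set P := B.p (k + (j + 1)) with hPdef
    set q := B.p (k + (j + 1 + 1)) with hqdef
    have hP : 0 < P := B.pos _
    have hqP : q ≤ P := B.antitone (by omega)
    -- Given `c`, the height lies in `[-P, P)` and `τ` in an interval of length at most `2 * P`.
    -- Landing in `[-q, q)` thus restricts the wrapping number to a range starting at `u c`, of
    -- length at most `(4 * P + 2 * q) / (2 * P) ≤ 3`.
    let u : ℝ → ℝ := fun c => (-P + (-P - c) / (j + 1) - q) / (2 * P)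
    refine ⟨Finset.image₂ (fun (c : ℝ) (i : ℕ) => c - (((⌊u c⌋ + 1 + i : ℤ) : ℝ)) * (2 * P)) S
      (Finset.range 3), ?_, ?_⟩
    · refine (Nat.cast_le.2 (Finset.card_image₂_le _ _ _)).trans ?_
      rw [Finset.card_range, pow_succ]
      push_cast
      linarith
    · intro τ hτ hr
      obtain ⟨c, hc, hcτ⟩ := hSr τ hτ (hr.mono (Nat.le_succ _))
      have h1 := hr (j + 1) (Nat.le_succ _)
      have h2 := hr (j + 1 + 1) le_rfl
      rw [orbit] at h2 ⊢
      obtain ⟨r, hrr⟩ := B.exists_wrap_eq ((k + (j + 1) : ℕ) : ℤ)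
        (B.orbit τ k (-B.p k) (j + 1) + τ)
      rw [hrr, height_natCast] at h2 ⊢
      rw [← hPdef, ← hqdef] at *
      rw [hcτ] at h1 h2 ⊢
      have hj : (0 : ℝ) < j + 1 := by positivity
      have hlow : (-P - c) / (j + 1) ≤ τ := by
        rw [div_le_iff₀ hj]; linarith [h1.1]
      have hupp : τ < (P - c) / (j + 1) := by
        rw [lt_div_iff₀ hj]; linarith [h1.2]
      have hlen : (P - c) / (j + 1) ≤ (-P - c) / (j + 1) + 2 * P := by
        rw [div_add' _ _ _ hj.ne']
        gcongr
        nlinarith [mul_nonneg hP.le (Nat.cast_nonneg (α := ℝ) j)]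
      have hr1 : ⌊u c⌋ < r := by
        rw [Int.floor_lt, div_lt_iff₀ (by positivity)]
        linarith [h1.1, h2.2]
      have hr3 : r - 3 ≤ ⌊u c⌋ := by
        rw [Int.le_floor, le_div_iff₀ (by positivity)]
        push_cast
        linarith [h1.2, h2.1]
      refine ⟨_, Finset.mem_image₂.2 ⟨c, hc, (r - ⌊u c⌋ - 1).toNat, ?_, rfl⟩, ?_⟩
      · rw [Finset.mem_range]; omega
      · rw [Int.toNat_of_nonneg (by omega)]; push_cast; ring

lemma volume_reaches_inter_Icc_le (B : StepBilliard) (k : ℕ) {a b : ℝ} (hab : a ≤ b) (j : ℕ) :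
    volume ({τ | B.Reaches τ k (j + 1) (-B.p k)} ∩ Icc a b) ≤
      ENNReal.ofReal (((b - a) / (2 * B.p k) + 2) * 3 ^ j *
        (2 * B.p (k + (j + 1)) / (j + 1))) := by
  obtain ⟨S, hS, hSr⟩ := B.exists_offsets k hab j
  have hj : (0 : ℝ) < j + 1 := by positivity
  have hP := B.pos (k + (j + 1))
  have hsub : {τ | B.Reaches τ k (j + 1) (-B.p k)} ∩ Icc a b ⊆
      ⋃ c ∈ S, Ico ((-B.p (k + (j + 1)) - c) / (j + 1)) ((B.p (k + (j + 1)) - c) / (j + 1)) := by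
    rintro τ ⟨hr, hτ⟩
    obtain ⟨c, hc, h⟩ := hSr τ hτ hr
    have h1 := hr (j + 1) le_rfl
    rw [h] at h1
    refine mem_iUnion₂.2 ⟨c, hc, ?_, ?_⟩
    · rw [div_le_iff₀ hj]; linarith [h1.1]
    · rw [lt_div_iff₀ hj]; linarith [h1.2]
  calc _ ≤ _ := measure_mono hsub
    _ ≤ _ := measure_biUnion_finset_le _ _
    _ = S.card * ENNReal.ofReal (2 * B.p (k + (j + 1)) / (j + 1)) := by
      simp only [Real.volume_Ico, ← sub_div]
      rw [← nsmul_eq_mul, ← Finset.sum_const]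
      refine Finset.sum_congr rfl fun c _ => ?_
      congr 2
      ring
    _ ≤ _ := by
      rw [← ENNReal.ofReal_natCast, ← ENNReal.ofReal_mul (Nat.cast_nonneg _)]
      gcongr

/-- Slopes for which the trajectory of some corner `(k, -p k)` with `k < n` reaches the `n`-th
aperture directly. -/
def cornerSlopes (B : StepBilliard) (n : ℕ) : Set ℝ :=
  {τ | ∃ k < n, B.Reaches τ k (n - k) (-B.p k)}

lemma p_add_le (B : StepBilliard) {lam : ℝ} (h0 : 0 < lam)
    (hp : ∀ n : ℕ, B.p (n + 1) ≤ lam * B.p n) (k j : ℕ) : B.p (k + j) ≤ lam ^ j * B.p k := by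
  induction j with
  | zero => simp
  | succ j ih =>
    calc B.p (k + j + 1) ≤ lam * B.p (k + j) := hp _
      _ ≤ lam * (lam ^ j * B.p k) := by gcongr
      _ = lam ^ (j + 1) * B.p k := by ring

lemma sum_three_pow_le (n : ℕ) : ∑ j ∈ Finset.range n, (3 : ℝ) ^ j ≤ 3 ^ n := by
  induction n with
  | zero => simp
  | succ n ih =>
    rw [Finset.sum_range_succ, pow_succ]
    have : (0 : ℝ) < 3 ^ n := by positivity
    linarith

lemma sum_three_pow_mul_pow_le {lam : ℝ} (h0 : 0 < lam) (h : lam ≤ 29 / 100) (n : ℕ) :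
    ∑ j ∈ Finset.range (n + 2), 3 ^ j * lam ^ (j + 1) / (j + 1) ≤ 49 / 50 := by
  -- For `j ≥ 2` the term is at most `(87/100) ^ (j + 1) / 9`. The subtracted quantity is the
  -- geometric tail of these bounds from `j = n + 2` on, as `9 * (1 - 87/100) = 117/100`.
  suffices H : ∑ j ∈ Finset.range (n + 2), (3 : ℝ) ^ j * (29 / 100) ^ (j + 1) / (j + 1) ≤
      49 / 50 - (87 / 100) ^ (n + 3) * (100 / 117) by
    refine (Finset.sum_le_sum fun j _ => ?_).trans
      (H.trans (sub_le_self _ (by positivity)))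
    gcongr
  induction n with
  | zero => norm_num [Finset.sum_range_succ]
  | succ n ih =>
    rw [show n + 1 + 2 = (n + 2) + 1 by ring, Finset.sum_range_succ]
    have h1 : (3 : ℝ) ^ (n + 2) * (29 / 100) ^ (n + 2 + 1) / (((n + 2 : ℕ) : ℝ) + 1) ≤
        (87 / 100) ^ (n + 3) / 9 := by
      have h2 : (3 : ℝ) ^ (n + 2) * (29 / 100) ^ (n + 2 + 1) = (87 / 100) ^ (n + 3) / 3 := by
        rw [show (87 / 100 : ℝ) = 3 * (29 / 100) by norm_num, mul_pow]; ring
      rw [h2, div_div]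
      gcongr
      push_cast
      have : (0 : ℝ) ≤ n := n.cast_nonneg
      linarith
    have h3 : (87 / 100 : ℝ) ^ (n + 1 + 3) = (87 / 100) ^ (n + 3) * (87 / 100) := by ring
    rw [h3]
    linarith

lemma volume_cornerSlopes_inter_Icc_le (B : StepBilliard) {lam : ℝ} (h0 : 0 < lam)
    (h : lam ≤ 29 / 100) (hp : ∀ n : ℕ, B.p (n + 1) ≤ lam * B.p n) {a b : ℝ} (hab : a ≤ b)
    (n : ℕ) :
    volume (B.cornerSlopes (n + 2) ∩ Icc a b) ≤
      ENNReal.ofReal (49 / 50 * (b - a) + 4 * (3 * lam) ^ (n + 2)) := by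
  -- The corners are indexed by `j`, one less than the number of strips to cross. The second summand
  -- stems from the `+ 2` in the count of offsets.
  have hterm : ∀ j ∈ Finset.range (n + 2),
      volume ({τ | B.Reaches τ (n + 1 - j) (j + 1) (-B.p (n + 1 - j))} ∩ Icc a b) ≤
        ENNReal.ofReal ((b - a) * (3 ^ j * lam ^ (j + 1) / (j + 1)) +
          4 * lam ^ (n + 2) * 3 ^ j) := by
    intro j hj
    rw [Finset.mem_range] at hj
    refine (B.volume_reaches_inter_Icc_le (n + 1 - j) hab j).trans
      (ENNReal.ofReal_le_ofReal ?_)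
    have h1 := B.p_add_le h0 hp (n + 1 - j) (j + 1)
    have h2 := B.p_add_le h0 hp 0 (n + 2)
    have hn : n + 1 - j + (j + 1) = n + 2 := by omega
    rw [hn] at h1 ⊢
    rw [B.zero_eq_one, mul_one, Nat.zero_add] at h2
    have hk := B.pos (n + 1 - j)
    have hN := B.pos (n + 2)
    have hba : 0 ≤ b - a := sub_nonneg.2 hab
    have hj0 : (0 : ℝ) ≤ j := j.cast_nonneg
    have e : ((b - a) / (2 * B.p (n + 1 - j)) + 2) * 3 ^ j * (2 * B.p (n + 2) / (j + 1)) =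
        (b - a) * (3 ^ j * (B.p (n + 2) / B.p (n + 1 - j)) / (j + 1)) +
          4 * (B.p (n + 2) / (j + 1)) * 3 ^ j := by
      field_simp
      ring
    rw [e]
    have h3 : B.p (n + 2) / (j + 1) ≤ lam ^ (n + 2) :=
      (div_le_self hN.le (by linarith)).trans h2
    have h4 : B.p (n + 2) / B.p (n + 1 - j) ≤ lam ^ (j + 1) := (div_le_iff₀ hk).2 h1
    gcongr
  have hsub : B.cornerSlopes (n + 2) ∩ Icc a b ⊆ ⋃ j ∈ Finset.range (n + 2),
      ({τ | B.Reaches τ (n + 1 - j) (j + 1) (-B.p (n + 1 - j))} ∩ Icc a b) := by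
    rintro τ ⟨⟨k, hk, hr⟩, hτ⟩
    refine mem_iUnion₂.2 ⟨n + 1 - k, Finset.mem_range.2 (by omega), ?_, hτ⟩
    rw [mem_ofPred_eq, show n + 1 - (n + 1 - k) = k by omega,
      show n + 1 - k + 1 = n + 2 - k by omega]
    exact hr
  have hba : 0 ≤ b - a := sub_nonneg.2 hab
  calc _ ≤ _ := measure_mono hsub
    _ ≤ _ := measure_biUnion_finset_le _ _
    _ ≤ _ := Finset.sum_le_sum hterm
    _ = _ := (ENNReal.ofReal_sum_of_nonneg fun j _ => by positivity).symm
    _ ≤ _ := by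
      refine ENNReal.ofReal_le_ofReal ?_
      rw [Finset.sum_add_distrib, ← Finset.mul_sum, ← Finset.mul_sum, mul_pow,
        mul_comm (49 / 50 : ℝ), mul_comm ((3 : ℝ) ^ (n + 2)), ← mul_assoc (4 : ℝ)]
      have h1 := sum_three_pow_mul_pow_le h0 h n
      have h2 := sum_three_pow_le (n + 2)
      gcongr

end StepBilliard

/-! ### Density argument and conclusion -/

/-- A set which occupies at most a fixed proportion `c < 1` of every interval is a null set. -/
lemma volume_eq_zero_of_inter_Icc_le {s : Set ℝ} {c : ℝ} (hc : c < 1)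
    (h : ∀ a b : ℝ, a < b → volume (s ∩ Icc a b) ≤ ENNReal.ofReal (c * (b - a))) :
    volume s = 0 := by
  rw [← Measure.restrict_eq_zero, ← ae_eq_bot, ← eventually_false_iff_eq_bot]
  -- Almost every point of `s`, measurable or not, has density 1 in `s`, but the proportions are
  -- bounded by `c < 1`.
  filter_upwards [Besicovitch.ae_tendsto_measure_inter_div volume s] with x hx
  have hlt : ENNReal.ofReal c < 1 := by
    rw [← ENNReal.ofReal_one]; exact (ENNReal.ofReal_lt_ofReal_iff one_pos).2 hc
  refine absurd (le_of_tendsto hx ?_) hlt.not_ge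
  filter_upwards [self_mem_nhdsWithin] with r hr
  have hr0 : (0 : ℝ) < r := hr
  have h1 := h (x - r) (x + r) (by linarith)
  rw [ENNReal.ofReal_mul' (by linarith), ← Real.volume_Icc] at h1
  rw [Real.closedBall_eq_Icc]
  exact ENNReal.div_le_of_le_mul h1

namespace StepBilliard

lemma volume_eventually_cornerSlopes (B : StepBilliard) {lam : ℝ} (h0 : 0 < lam)
    (h : lam ≤ 29 / 100) (hp : ∀ n : ℕ, B.p (n + 1) ≤ lam * B.p n) :
    volume {τ | ∀ᶠ n in atTop, τ ∈ B.cornerSlopes n} = 0 := by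
  have hN : ∀ N : ℕ, volume {τ | ∀ n ≥ N, τ ∈ B.cornerSlopes n} = 0 := fun N => by
    refine volume_eq_zero_of_inter_Icc_le (c := 49 / 50) (by norm_num) fun a b hab => ?_
    -- As `3 * lam < 1`, the error disappears when `n → ∞` with `a, b` fixed.
    have hlim : Tendsto (fun n : ℕ => 49 / 50 * (b - a) + 4 * (3 * lam) ^ (n + 2)) atTop
        (𝓝 (49 / 50 * (b - a) + 4 * 0)) :=
      (((tendsto_pow_atTop_nhds_zero_of_lt_one (by linarith)
        (by linarith)).comp (tendsto_add_atTop_nat 2)).const_mul 4).const_add _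
    rw [mul_zero, add_zero] at hlim
    refine ge_of_tendsto (ENNReal.tendsto_ofReal hlim) ?_
    filter_upwards [eventually_ge_atTop N] with n hn
    have hsub : {τ | ∀ n ≥ N, τ ∈ B.cornerSlopes n} ⊆ B.cornerSlopes (n + 2) :=
      fun τ hτ => hτ (n + 2) (by omega)
    exact (measure_mono (inter_subset_inter_left _ hsub)).trans
      (B.volume_cornerSlopes_inter_Icc_le h0 h hp hab.le n)
  refine measure_mono_null (fun τ hτ => ?_) (measure_iUnion_null hN)
  obtain ⟨N, h⟩ := eventually_atTop.1 hτ
  exact mem_iUnion.2 ⟨N, h⟩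

lemma numIntervals_directSet (B : StepBilliard) {θ : ℝ} (hθ : 0 < cos θ) {n : ℕ}
    (h : tan θ ∉ B.cornerSlopes n) : numIntervals (B.directSet θ n) = 1 := by
  obtain ⟨a, ha⟩ := B.exists_eq_Ico_of_corners (tan θ) n 0 fun i hi hr =>
    h ⟨i, hi, by rwa [Nat.zero_add] at hr⟩
  rw [directSet_eq B hθ, ha]
  exact numIntervals_Ico (by linarith [B.pos (0 + n)])

end StepBilliard

theorem mainTheorem2 (B : StepBilliard) (lam : ℝ) (hlam0 : 0 < lam)
    (hlam : lam < (Real.sqrt 6 - 1) / 5) (hp : ∀ n : ℕ, B.p (n + 1) ≤ lam * B.p n) :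
    ∀ᵐ θ ∂(volume.restrict (Ioo (0 : ℝ) (π / 2))),
      ∃ nj : ℕ → ℕ, StrictMono nj ∧
        ∀ j : ℕ, numIntervals (B.directSet θ (nj j)) = 1 := by
  -- Only this rational bound, slightly above `λ₀`, is needed.
  have hlam1 : lam ≤ 29 / 100 := by
    have : Real.sqrt 6 ≤ 245 / 100 := Real.sqrt_le_iff.2 ⟨by norm_num, by norm_num⟩
    linarith
  -- A differentiable map preserves null sets, which carries the result from slopes to angles.
  have hnull : volume (arctan '' {τ | ∀ᶠ n in atTop, τ ∈ B.cornerSlopes n}) = 0 :=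
    addHaar_image_eq_zero_of_differentiableOn_of_addHaar_eq_zero volume
      differentiable_arctan.differentiableOn
      (B.volume_eventually_cornerSlopes hlam0 hlam1 hp)
  rw [ae_restrict_iff' measurableSet_Ioo]
  filter_upwards [compl_mem_ae_iff.2 hnull] with θ hθ hθI
  have hcos : 0 < cos θ := cos_pos_of_mem_Ioo ⟨by linarith [hθI.1, pi_pos], hθI.2⟩
  have hfreq : ∃ᶠ n in atTop, tan θ ∉ B.cornerSlopes n := fun hev =>
    hθ ⟨tan θ, by simpa only [mem_ofPred_eq, not_not] using hev,
      arctan_tan (by linarith [hθI.1, pi_pos]) hθI.2⟩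
  obtain ⟨nj, hmono, hnj⟩ := extraction_of_frequently_atTop hfreq
  exact ⟨nj, hmono, fun j => B.numIntervals_directSet hcos (hnj j)⟩
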